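/- Let $G$ be a locally compact (Hausdorff) group with identity $e$, and let $K\subseteq G$ be a compact subgroup with normalized Haar measure $\omega$. Let $\mathcal C(G)$ be the space of continuous functions $G\to\mathbb C$ with the topology of uniform convergence on compact sets, and let $\mathcal M_c(G)$ be its dual, identified with the space of compactly supported complex (Radon) measures on $G$, with the weak* topology and the pairing $\langle\mu,f\rangle=\int f\,d\mu$. Write $\check f(x)=f(x^{-1})$ and $$f^{\#}(x)=\int_K\int_K f(kxl)\,d\omega(k)\,d\omega(l),\qquad \langle\mu*\nu,f\rangle=\int\!\!\int f(xy)\,d\mu(x)\,d\nu(y),\qquad (\mu*f)(x)=\int f(y^{-1}x)\,d\mu(y).$$ A function $f\in\mathcal C(G)$ is $K$-invariant if $f(kxl)=f(x)$ for all $x\in G$ and $k,l\in K$; a measure $\mu\in\mathcal M_c(G)$ is $K$-invariant if $\langle\mu,f\rangle=\langle\mu,f^{\#}\rangle$ for all $f\in\mathcal C(G)$. The $K$-invariant measures form a unital algebra $\mathcal M_c(G//K)$ under convolution, with the (relative) weak* topology; for $y\in G$ it contains the measure $\delta_y^{\#}$ given by $\langle\delta_y^{\#},f\rangle=f^{\#}(y)$,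 and its unit is $\delta_e^{\#}$. Assume that $(G,K)$ is a Gelfand pair, i.e. that $\mathcal M_c(G//K)$ is commutative. For $y\in G$ let $\tau_yf=\delta_{y^{-1}}^{\#}*f$, that is, $\tau_yf(x)=\int_K\int_K f(kylx)\,d\omega(k)\,d\omega(l)$. For a $K$-invariant $f\in\mathcal C(G)$ let $M_f$ be the closure of the ideal of $\mathcal M_c(G//K)$ generated by all $\delta_{y^{-1}}^{\#}-f(y)\,\delta_e^{\#}$ with $y\in G$. Call $f$ normed if $f(e)=1$, and $K$-spherical if it is nonzero, $K$-invariant and satisfies $$\int_K f(xky)\,d\omega(k)=f(x)f(y)\qquad\text{for all }x,y\in G.\tag{1}$$ A maximal ideal of $\mathcal M_c(G//K)$ is exponential if it is the kernel of a continuous algebra homomorphism of $\mathcal M_c(G//K)$ onto $\mathbb C$. **Theorem.** Let $f\in\mathcal C(G)$ be $K$-invariant. The following statements are equivalent: 1. $f$ is a $K$-spherical function. 2. $f$ is nonzero and satisfies (1). 3. $f$ is normed, and for each $K$-invariant measure $\mu\in\mathcal M_c(G)$ there is a complex number $\lambda_\mu$ with $\mu*f=\lambda_\mu f$. 4. $f$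 is normed, and it is an eigenfunction of $\tau_y$ for every $y\in G$, i.e. for each $y\in G$ there is a complex number $c_y$ with $\tau_yf=c_yf$. 5. $f$ is normed, and $M_f$ is an exponential maximal ideal. 6. $f$ is normed, and $\mu\mapsto\langle\mu,\check f\rangle$ is a nonzero multiplicative linear functional on the algebra $\mathcal M_c(G//K)$ with kernel $M_f$. -/

import Mathlib

open MeasureTheory Topology

noncomputable section

namespace GelfandPairs

/-! ### Compactly supported measures as functionals

Throughout, `G` is a locally compact Hausdorff group, `K` is a compact subgroup of `G`, and
`C(G, ℂ)` carries the compact-open topology, i.e. uniform convergence on compact sets. -/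

/-- The space `M_c(G)` of compactly supported complex (Radon) measures on `G`: the dual of
`C(G, ℂ)` with its weak* topology. The pairing `⟨μ, f⟩` is the evaluation `μ f`. -/
abbrev CompMeasure (G : Type*) [TopologicalSpace G] : Type _ := WeakDual ℂ C(G, ℂ)

section Haar

variable {G : Type*} [Group G] [TopologicalSpace G] [IsTopologicalGroup G]
  [MeasurableSpace G] [BorelSpace G] (K : Subgroup G) [CompactSpace K]

/-- The Haar measure `ω` of the compact group `K`, normalized to total mass one. -/
def normHaar : Measure K := Measure.haarMeasure ⊤

instance : (normHaar K).IsHaarMeasure := by unfold normHaar; infer_instance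

instance : IsProbabilityMeasure (normHaar K) := ⟨by
  have h := Measure.haarMeasure_self (K₀ := (⊤ : TopologicalSpace.PositiveCompacts K))
  simpa [normHaar] using h⟩

instance [T2Space G] : (normHaar K).IsMulRightInvariant := ⟨fun g => by
  have hm : Measurable (fun x : K => x * g) := measurable_mul_const g
  have : IsProbabilityMeasure (Measure.map (fun x : K => x * g) (normHaar K)) :=
    Measure.isProbabilityMeasure_map hm.aemeasurable
  exact Measure.isHaarMeasure_eq_of_isProbabilityMeasure _ _⟩

instance [T2Space G] : (normHaar K).IsInvInvariant := ⟨by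
  have h1 : (normHaar K).inv.IsHaarMeasure := by
    refine Measure.isHaarMeasure_of_isCompact_nonempty_interior _ Set.univ isCompact_univ
      (by simp) ?_ ?_
    · simp
    · simp
  have : IsProbabilityMeasure (normHaar K).inv :=
    Measure.isProbabilityMeasure_map measurable_inv.aemeasurable
  exact Measure.isHaarMeasure_eq_of_isProbabilityMeasure _ _⟩

lemma continuous_integrable {X : Type*} [TopologicalSpace X] [CompactSpace X] [MeasurableSpace X]
    [BorelSpace X] (ν : Measure X) [IsFiniteMeasure ν] {E : Type*} [NormedAddCommGroup E]
    {f : X → E} (hf : Continuous f) : Integrable f ν :=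
  hf.integrable_of_hasCompactSupport (HasCompactSupport.of_compactSpace f)

/-- Integration against `ω`, as a continuous linear functional on `C(K, ℂ)`. -/
def haarInt : C(K, ℂ) →L[ℂ] ℂ :=
  LinearMap.mkContinuous
    { toFun := fun f => ∫ k, f k ∂(normHaar K)
      map_add' := fun f g => integral_add
        (continuous_integrable _ f.continuous) (continuous_integrable _ g.continuous)
      map_smul' := fun c f => integral_const_mul c _ } 1
    (fun f => by
      have h := norm_integral_le_of_norm_le_const (μ := normHaar K)
        (Filter.Eventually.of_forall fun k => f.norm_coe_le_norm k)
      simpa using h)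

end Haar

section Restrict

/-- A continuous functional on `C(X, ℂ)` factors through the restriction to some compact set. -/
lemma exists_compact_factor {X : Type*} [TopologicalSpace X] (φ : C(X, ℂ) →L[ℂ] ℂ) :
    ∃ L : Set X, ∃ _ : CompactSpace L, ∃ g : C(L, ℂ) →L[ℂ] ℂ, ∀ f, φ f = g (f.restrict L) := by
  have hmem : {f : C(X, ℂ) | ‖φ f‖ < 1} ∈ 𝓝 (0 : C(X, ℂ)) := by
    refine (isOpen_lt (by fun_prop) continuous_const).mem_nhds ?_
    simp
  obtain ⟨⟨L, V⟩, ⟨hL, hV⟩, hsub⟩ :=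
    (nhds_basis_uniformity'
      (ContinuousMap.hasBasis_compactConvergenceUniformity (α := X) (β := ℂ))).mem_iff.1 hmem
  obtain ⟨ε, hε, hεV⟩ := Metric.mem_uniformity_dist.1 hV
  have hcomp : CompactSpace L := isCompact_iff_compactSpace.1 hL
  have key : ∀ f : C(X, ℂ), (∀ x ∈ L, ‖f x‖ < ε) → ‖φ f‖ < 1 := by
    intro f hf
    refine hsub (a := f) ?_
    intro x hx
    refine hεV ?_
    simpa [dist_eq_norm] using hf x hx
  let R : C(X, ℂ) →ₗ[ℂ] C(L, ℂ) :=
    { toFun := fun f => f.restrict L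
      map_add' := fun _ _ => rfl
      map_smul' := fun _ _ => rfl }
  have bound : ∀ f : C(X, ℂ), ‖φ f‖ ≤ (2 / ε) * ‖R f‖ := by
    intro f
    have hx : ∀ x ∈ L, ‖f x‖ ≤ ‖R f‖ := fun x hx => (R f).norm_coe_le_norm ⟨x, hx⟩
    rcases (norm_nonneg (R f)).eq_or_lt with h0 | hpos
    · rw [← h0, mul_zero]
      by_contra hne
      push Not at hne
      have h1 := key (((‖φ f‖⁻¹ : ℝ) : ℂ) • f) (by
        intro x hxL
        have : ‖f x‖ = 0 := le_antisymm (h0 ▸ hx x hxL) (norm_nonneg _)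
        simp [this, hε])
      simp only [map_smul, norm_smul, Complex.norm_real, norm_inv, norm_norm] at h1
      rw [inv_mul_cancel₀ hne.ne'] at h1
      exact lt_irrefl _ h1
    · have h1 := key (((ε / (2 * ‖R f‖) : ℝ) : ℂ) • f) (by
        intro x hxL
        have h2 : ‖(((ε / (2 * ‖R f‖) : ℝ) : ℂ) • f) x‖ = ε / (2 * ‖R f‖) * ‖f x‖ := by
          rw [ContinuousMap.smul_apply, norm_smul, Complex.norm_real, Real.norm_of_nonneg
            (by positivity)]
        rw [h2]
        calc ε / (2 * ‖R f‖) * ‖f x‖ ≤ ε / (2 * ‖R f‖) * ‖R f‖ := by gcongr; exact hx x hxL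
          _ = ε / 2 := by field_simp
          _ < ε := by linarith)
      rw [map_smul, norm_smul, Complex.norm_real, Real.norm_of_nonneg (by positivity)] at h1
      have h3 : ‖φ f‖ = (2 / ε) * ‖R f‖ * (ε / (2 * ‖R f‖) * ‖φ f‖) := by field_simp
      rw [h3]
      exact mul_le_of_le_one_right (by positivity) h1.le
  have hker : LinearMap.ker R.rangeRestrict ≤ LinearMap.ker φ.toLinearMap := by
    intro f hf
    have hf' : R f = 0 := congrArg Subtype.val (LinearMap.mem_ker.1 hf)
    have := bound f
    rw [hf', norm_zero, mul_zero] at this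
    exact LinearMap.mem_ker.2 (norm_le_zero_iff.1 this)
  obtain ⟨ψ, hψ⟩ : ∃ ψ : LinearMap.range R →ₗ[ℂ] ℂ, ∀ f, ψ (R.rangeRestrict f) = φ f := by
    let e := R.rangeRestrict.quotKerEquivOfSurjective R.surjective_rangeRestrict
    refine ⟨(Submodule.liftQ _ φ.toLinearMap hker).comp e.symm.toLinearMap, fun f => ?_⟩
    have : e.symm (R.rangeRestrict f) = Submodule.Quotient.mk f := by
      rw [LinearEquiv.symm_apply_eq]
      rfl
    simp [this]
  obtain ⟨g, hg, -⟩ := exists_extension_norm_eq (LinearMap.range R)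
    (ψ.mkContinuous (2 / ε) (by
      rintro ⟨_, f, rfl⟩
      exact (congrArg norm (hψ f)).trans_le (bound f)))
  exact ⟨L, hcomp, g, fun f => ((hg (R.rangeRestrict f)).trans (hψ f)).symm⟩

/-- A continuous functional commutes with integration over a compact parameter space. -/
lemma functional_integral {X S : Type*} [TopologicalSpace X] [TopologicalSpace S] [CompactSpace S]
    [MeasurableSpace S] [BorelSpace S] (ν : Measure S) [IsFiniteMeasure ν]
    (φ : C(X, ℂ) →L[ℂ] ℂ) (F : C(S, C(X, ℂ))) (f : C(X, ℂ))
    (hf : ∀ x, f x = ∫ s, F s x ∂ν) : φ f = ∫ s, φ (F s) ∂ν := by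
  obtain ⟨L, hL, g, hg⟩ := exists_compact_factor φ
  have hc : Continuous fun s => (F s).restrict L :=
    (ContinuousMap.continuous_restrict L).comp F.continuous
  have hi : Integrable (fun s => (F s).restrict L) ν := continuous_integrable ν hc
  have h1 : f.restrict L = ∫ s, (F s).restrict L ∂ν := by
    ext x
    have := (ContinuousMap.evalCLM ℂ x).integral_comp_comm hi
    simp only [ContinuousMap.evalCLM_apply] at this
    rw [← this]
    exact hf x
  rw [hg, h1, ← g.integral_comp_comm hi]
  simp only [hg]

end Restrict

section Functions

variable {G : Type*} [Group G] [TopologicalSpace G] [IsTopologicalGroup G]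

/-- `f̌(x) = f(x⁻¹)`. -/
def check (f : C(G, ℂ)) : C(G, ℂ) := f.comp ⟨fun x => x⁻¹, continuous_inv⟩

@[simp] lemma check_apply (f : C(G, ℂ)) (x : G) : check f x = f x⁻¹ := rfl

/-- The left translate `y ↦ f (x * y)`, depending continuously on `x`. -/
def lshift (f : C(G, ℂ)) : C(G, C(G, ℂ)) :=
  ContinuousMap.curry ⟨fun p : G × G => f (p.1 * p.2), by fun_prop⟩

@[simp] lemma lshift_apply (f : C(G, ℂ)) (x y : G) : lshift f x y = f (x * y) := rfl

/-- `f` is (bi-)`K`-invariant: `f (k x l) = f x` for `k, l ∈ K`. -/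
def IsInvariantFun (K : Subgroup G) (f : C(G, ℂ)) : Prop :=
  ∀ x : G, ∀ k ∈ K, ∀ l ∈ K, f (k * x * l) = f x

/-- The convolution `(μ * f)(x) = ∫ f (y⁻¹ x) dμ(y)` of a measure and a function. -/
def act (μ : CompMeasure G) (f : C(G, ℂ)) : C(G, ℂ) where
  toFun x := μ ⟨fun y => f (y⁻¹ * x), by fun_prop⟩
  continuous_toFun := (map_continuous μ).comp
    (ContinuousMap.curry ⟨fun p : G × G => f (p.2⁻¹ * p.1), by fun_prop⟩).continuous

variable [LocallyCompactSpace G]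

/-- The map `f ↦ (x ↦ ⟨ν, y ↦ f (x y)⟩)` on `C(G, ℂ)`. -/
def slice (ν : CompMeasure G) : C(G, ℂ) →L[ℂ] C(G, ℂ) where
  toFun f := ⟨fun x => ν (lshift f x), (map_continuous ν).comp (lshift f).continuous⟩
  map_add' f g := by
    ext x
    exact map_add ν (lshift f x) (lshift g x)
  map_smul' c f := by
    ext x
    exact map_smul ν c (lshift f x)
  cont := by
    have h1 : Continuous fun f : C(G, ℂ) =>
        f.comp (⟨fun p : G × G => p.1 * p.2, continuous_mul⟩ : C(G × G, G)) :=
      ContinuousMap.continuous_precomp _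
    have h2 : Continuous fun F : C(G, C(G, ℂ)) =>
        (⟨ν, map_continuous ν⟩ : C(C(G, ℂ), ℂ)).comp F :=
      ContinuousMap.continuous_postcomp _
    exact h2.comp (ContinuousMap.continuous_curry.comp h1)

/-- The convolution `⟨μ * ν, f⟩ = ∫∫ f (x y) dν(y) dμ(x)` of measures in `M_c(G)`. -/
def conv (μ ν : CompMeasure G) : CompMeasure G :=
  StrongDual.toWeakDual ((WeakDual.toStrongDual μ).comp (slice ν))

lemma conv_apply (μ ν : CompMeasure G) (f : C(G, ℂ)) :
    conv μ ν f = μ ⟨fun x => ν ⟨fun y => f (x * y), by fun_prop⟩,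
      (map_continuous ν).comp (lshift f).continuous⟩ := rfl

end Functions

section Projection

variable {G : Type*} [Group G] [TopologicalSpace G] [IsTopologicalGroup G] [LocallyCompactSpace G]
  [MeasurableSpace G] [BorelSpace G] (K : Subgroup G) [CompactSpace K]

/-- Averaging on the right, `x ↦ ∫ f (x l) dω(l)`. -/
def avgR : C(G, ℂ) →L[ℂ] C(G, ℂ) where
  toFun f := ⟨fun x => haarInt K ⟨fun l : K => f (x * l), by fun_prop⟩,
    (haarInt K).continuous.comp
      (ContinuousMap.curry ⟨fun p : G × K => f (p.1 * p.2), by fun_prop⟩).continuous⟩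
  map_add' f g := by
    ext x
    exact map_add (haarInt K) (⟨fun l : K => f (x * l), by fun_prop⟩ : C(K, ℂ))
      ⟨fun l : K => g (x * l), by fun_prop⟩
  map_smul' c f := by
    ext x
    exact map_smul (haarInt K) c (⟨fun l : K => f (x * l), by fun_prop⟩ : C(K, ℂ))
  cont := by
    have h1 : Continuous fun f : C(G, ℂ) =>
        f.comp (⟨fun p : G × K => p.1 * p.2, by fun_prop⟩ : C(G × K, G)) :=
      ContinuousMap.continuous_precomp _
    have h2 : Continuous fun F : C(G, C(K, ℂ)) =>
        (⟨haarInt K, (haarInt K).continuous⟩ : C(C(K, ℂ), ℂ)).comp F :=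
      ContinuousMap.continuous_postcomp _
    exact h2.comp (ContinuousMap.continuous_curry.comp h1)

/-- Averaging on the left, `x ↦ ∫ f (k x) dω(k)`. -/
def avgL : C(G, ℂ) →L[ℂ] C(G, ℂ) where
  toFun f := ⟨fun x => haarInt K ⟨fun k : K => f (k * x), by fun_prop⟩,
    (haarInt K).continuous.comp
      (ContinuousMap.curry ⟨fun p : G × K => f (p.2 * p.1), by fun_prop⟩).continuous⟩
  map_add' f g := by
    ext x
    exact map_add (haarInt K) (⟨fun k : K => f (k * x), by fun_prop⟩ : C(K, ℂ))
      ⟨fun k : K => g (k * x), by fun_prop⟩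
  map_smul' c f := by
    ext x
    exact map_smul (haarInt K) c (⟨fun k : K => f (k * x), by fun_prop⟩ : C(K, ℂ))
  cont := by
    have h1 : Continuous fun f : C(G, ℂ) =>
        f.comp (⟨fun p : G × K => p.2 * p.1, by fun_prop⟩ : C(G × K, G)) :=
      ContinuousMap.continuous_precomp _
    have h2 : Continuous fun F : C(G, C(K, ℂ)) =>
        (⟨haarInt K, (haarInt K).continuous⟩ : C(C(K, ℂ), ℂ)).comp F :=
      ContinuousMap.continuous_postcomp _
    exact h2.comp (ContinuousMap.continuous_curry.comp h1)

lemma avgR_apply (f : C(G, ℂ)) (x : G) : avgR K f x = ∫ l : K, f (x * l) ∂(normHaar K) := rfl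

lemma avgL_apply (f : C(G, ℂ)) (x : G) : avgL K f x = ∫ k : K, f (k * x) ∂(normHaar K) := rfl

/-- The projection `f^#(x) = ∫∫ f (k x l) dω(k) dω(l)`, see `proj_apply`. -/
def proj : C(G, ℂ) →L[ℂ] C(G, ℂ) := (avgR K).comp (avgL K)

lemma proj_apply (f : C(G, ℂ)) (x : G) :
    proj K f x = ∫ l : K, ∫ k : K, f (k * x * l) ∂(normHaar K) ∂(normHaar K) := by
  simp only [mul_assoc]
  rfl

variable {K} in
lemma proj_eq_self {f : C(G, ℂ)} (hf : IsInvariantFun K f) : proj K f = f := by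
  ext x
  simp [proj_apply, hf x _ (SetLike.coe_mem _) _ (SetLike.coe_mem _)]

/-- `μ^#`, given by `⟨μ^#, f⟩ = ⟨μ, f^#⟩`. -/
def projMeas (μ : CompMeasure G) : CompMeasure G :=
  StrongDual.toWeakDual ((WeakDual.toStrongDual μ).comp (proj K))

/-- The point mass `δ_x`. -/
def dirac (x : G) : CompMeasure G := StrongDual.toWeakDual (ContinuousMap.evalCLM ℂ x)

/-- The `K`-invariant measures `M_c(G//K)`: those `μ` in `M_c(G)` with `⟨μ, f⟩ = ⟨μ, f^#⟩` for all
`f`. The coercion to a type carries the subspace (that is, weak*) topology. -/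
def invMeasures : Submodule ℂ (CompMeasure G) where
  carrier := {μ | ∀ f, μ f = μ (proj K f)}
  add_mem' hμ hν f := congrArg₂ (· + ·) (hμ f) (hν f)
  zero_mem' _ := rfl
  smul_mem' c _ hμ f := congrArg (c • ·) (hμ f)

lemma avgR_avgR (f : C(G, ℂ)) : avgR K (avgR K f) = avgR K f := by
  ext x
  simp only [avgR_apply]
  have h : ∀ l : K, ∫ l' : K, f (x * l * l') ∂(normHaar K) = ∫ l' : K, f (x * l') ∂(normHaar K) := by
    intro l
    have := integral_mul_left_eq_self (μ := normHaar K) (fun l' : K => f (x * l')) l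
    simpa [mul_assoc] using this
  simp [h]

lemma avgL_avgR (f : C(G, ℂ)) : avgL K (avgR K f) = avgR K (avgL K f) := by
  ext x
  simp only [avgL_apply, avgR_apply]
  rw [integral_integral_swap_of_hasCompactSupport (f := fun (k l : K) => f (k * x * l))
    (by simp only [Function.uncurry_def]; fun_prop) (HasCompactSupport.of_compactSpace _)]
  simp only [mul_assoc]

variable {K} in
lemma coe_eq_of_apply {μ ν : invMeasures K} (h : ∀ f, μ.1 f = ν.1 f) : μ = ν :=
  Subtype.ext (DFunLike.ext _ _ h)

variable [T2Space G]

lemma avgL_avgL (f : C(G, ℂ)) : avgL K (avgL K f) = avgL K f := by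
  ext x
  simp only [avgL_apply]
  have h : ∀ k : K, ∫ k' : K, f (k' * (k * x)) ∂(normHaar K) = ∫ k' : K, f (k' * x) ∂(normHaar K) := by
    intro k
    have := integral_mul_right_eq_self (μ := normHaar K) (fun k' : K => f (k' * x)) k
    simpa [mul_assoc] using this
  simp [h]

lemma proj_proj (f : C(G, ℂ)) : proj K (proj K f) = proj K f := by
  change avgR K (avgL K (avgR K (avgL K f))) = avgR K (avgL K f)
  rw [avgL_avgR, avgL_avgL, avgR_avgR]

variable {K}

lemma projMeas_mem (μ : CompMeasure G) : projMeas K μ ∈ invMeasures K := fun f =>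
  congrArg μ (proj_proj K f).symm

lemma apply_avgR {μ : CompMeasure G} (hμ : μ ∈ invMeasures K) (f : C(G, ℂ)) :
    μ (avgR K f) = μ f := by
  rw [hμ (avgR K f), hμ f]
  congr 1
  change avgR K (avgL K (avgR K f)) = avgR K (avgL K f)
  rw [avgL_avgR, avgR_avgR]

lemma apply_avgL {μ : CompMeasure G} (hμ : μ ∈ invMeasures K) (f : C(G, ℂ)) :
    μ (avgL K f) = μ f := by
  rw [hμ (avgL K f), hμ f]
  congr 1
  change avgR K (avgL K (avgL K f)) = avgR K (avgL K f)
  rw [avgL_avgL]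

lemma conv_mem {μ ν : CompMeasure G} (hμ : μ ∈ invMeasures K) (hν : ν ∈ invMeasures K) :
    conv μ ν ∈ invMeasures K := by
  have hR : ∀ f, conv μ ν (avgR K f) = conv μ ν f := by
    intro f
    refine congrArg μ (?_ : slice ν (avgR K f) = slice ν f)
    ext x
    change ν (lshift (avgR K f) x) = ν (lshift f x)
    rw [← apply_avgR hν (lshift f x)]
    congr 1
    ext y
    simp only [avgR_apply, lshift_apply, mul_assoc]
  have hL : ∀ f, conv μ ν (avgL K f) = conv μ ν f := by
    intro f
    change μ (slice ν (avgL K f)) = μ (slice ν f)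
    rw [← apply_avgL hμ (slice ν f)]
    congr 1
    ext x
    rw [avgL_apply]
    refine functional_integral (normHaar K) (WeakDual.toStrongDual ν)
      ⟨fun k : K => lshift f (k * x), by fun_prop⟩ (lshift (avgL K f) x) ?_
    intro y
    simp only [avgL_apply, lshift_apply, mul_assoc, ContinuousMap.coe_mk]
  intro f
  change _ = conv μ ν (avgR K (avgL K f))
  rw [hR, hL]

/-- The measure `δ_x^#`, as an element of `M_c(G//K)`. -/
def diracProj (K : Subgroup G) [CompactSpace K] (x : G) : invMeasures K :=
  ⟨projMeas K (dirac x), projMeas_mem _⟩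

lemma diracProj_apply (x : G) (f : C(G, ℂ)) : (diracProj K x : CompMeasure G) f = proj K f x := rfl

/-- Convolution makes `M_c(G//K)` a ring. Its unit is `δ_e^#`, which coincides with `δ_e` as
a functional on `K`-invariant functions. -/
instance : Mul (invMeasures K) := ⟨fun μ ν => ⟨conv μ.1 ν.1, conv_mem μ.2 ν.2⟩⟩

instance : One (invMeasures K) := ⟨diracProj K 1⟩

lemma coe_mul (μ ν : invMeasures K) : ((μ * ν : invMeasures K) : CompMeasure G) = conv μ.1 ν.1 :=
  rfl

lemma one_def : (1 : invMeasures K) = diracProj K 1 := rfl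

instance : AddCommGroup (invMeasures K) := Module.addCommMonoidToAddCommGroup ℂ

instance : Ring (invMeasures K) where
  __ := (inferInstance : AddCommGroup (invMeasures K))
  mul_assoc μ ν ρ := coe_eq_of_apply fun f => by
    refine congrArg μ.1 (ContinuousMap.ext fun x => congrArg ν.1 (ContinuousMap.ext fun y =>
      congrArg ρ.1 (ContinuousMap.ext fun z => ?_)))
    simp [mul_assoc]
  one_mul μ := coe_eq_of_apply fun f => by
    change proj K (slice μ.1 f) 1 = μ.1 f
    have h : ∀ x ∈ K, slice μ.1 f x = μ.1 f := by
      intro x hx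
      change μ.1 (lshift f x) = μ.1 f
      rw [← apply_avgL μ.2 (lshift f x), ← apply_avgL μ.2 f]
      congr 1
      ext y
      have := integral_mul_left_eq_self (μ := normHaar K) (fun k : K => f (k * y)) ⟨x, hx⟩
      simpa [avgL_apply, mul_assoc] using this
    rw [proj_apply]
    simp [h _ (mul_mem (SetLike.coe_mem _) (SetLike.coe_mem _))]
  mul_one μ := coe_eq_of_apply fun f => by
    rw [← apply_avgR μ.2 f]
    refine congrArg μ.1 (ContinuousMap.ext fun x => ?_)
    change proj K (lshift f x) 1 = avgR K f x
    rw [proj_apply, avgR_apply]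
    have h : ∀ l : K, ∫ k : K, f (x * (k * l)) ∂(normHaar K)
        = ∫ k : K, f (x * k) ∂(normHaar K) := fun l =>
      integral_mul_right_eq_self (μ := normHaar K) (fun k : K => f (x * k)) l
    simp [h]
  left_distrib μ ν ρ := coe_eq_of_apply fun f => map_add μ.1 (slice ν.1 f) (slice ρ.1 f)
  right_distrib _ _ _ := rfl
  zero_mul _ := rfl
  mul_zero μ := coe_eq_of_apply fun _ => map_zero μ.1

instance : Algebra ℂ (invMeasures K) :=
  Algebra.ofModule (fun _ _ _ => rfl)
    (fun c μ ν => coe_eq_of_apply fun f => map_smul μ.1 c (slice ν.1 f))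

end Projection

section Spherical

variable {G : Type*} [Group G] [TopologicalSpace G] [IsTopologicalGroup G] [LocallyCompactSpace G]
  [T2Space G] [MeasurableSpace G] [BorelSpace G] (K : Subgroup G) [CompactSpace K]

/-- `(G, K)` is a Gelfand pair: the algebra `M_c(G//K)` is commutative. -/
class IsGelfandPair : Prop where
  mul_comm : ∀ μ ν : invMeasures K, μ * ν = ν * μ

/-- The spherical functional equation `∫ f (x k y) dω(k) = f x * f y`. -/
def SphericalEquation (f : C(G, ℂ)) : Prop :=
  ∀ x y : G, ∫ k : K, f (x * k * y) ∂(normHaar K) = f x * f y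

/-- A `K`-spherical function. -/
def IsSpherical (f : C(G, ℂ)) : Prop :=
  IsInvariantFun K f ∧ f ≠ 0 ∧ SphericalEquation K f

/-- `f` is normed: `f e = 1`. -/
def IsNormed (f : C(G, ℂ)) : Prop := f 1 = 1

/-- The `K`-translation `τ_y f = δ_{y⁻¹}^# * f`; explicitly,
`τ_y f (x) = ∫∫ f (k y l x) dω(k) dω(l)`, see `translate_apply`. -/
def translate (y : G) (f : C(G, ℂ)) : C(G, ℂ) := act (diracProj K y⁻¹ : CompMeasure G) f

lemma translate_apply (y : G) (f : C(G, ℂ)) (x : G) :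
    translate K y f x = ∫ l : K, ∫ k : K, f (k * y * l * x) ∂(normHaar K) ∂(normHaar K) := by
  have h0 : translate K y f x = ∫ l : K, ∫ k : K,
      f ((k * y⁻¹ * l)⁻¹ * x) ∂(normHaar K) ∂(normHaar K) := proj_apply K _ _
  rw [h0, integral_integral_swap_of_hasCompactSupport
    (f := fun (l k : K) => f ((k * y⁻¹ * l)⁻¹ * x))
    (by simp only [Function.uncurry_def]; fun_prop) (HasCompactSupport.of_compactSpace _),
    ← integral_inv_eq_self]
  congr 1
  ext l
  rw [← integral_inv_eq_self]
  simp [mul_assoc]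

/-- The modified spherical difference `D_{f;y} = δ_{y⁻¹}^# - f(y) δ_e` in `M_c(G//K)`. -/
def sphDiff (f : C(G, ℂ)) (y : G) : invMeasures K := diracProj K y⁻¹ - f y • 1

lemma continuous_mul_right (ν : invMeasures K) : Continuous fun μ : invMeasures K => μ * ν := by
  refine Continuous.subtype_mk (WeakDual.continuous_of_continuous_eval fun f => ?_) _
  exact (WeakDual.eval_continuous (slice ν.1 f)).comp continuous_subtype_val

instance : ContinuousAdd (invMeasures K) := ⟨by
  refine Continuous.subtype_mk (WeakDual.continuous_of_continuous_eval fun f => ?_) _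
  exact ((WeakDual.eval_continuous f).comp (continuous_subtype_val.comp continuous_fst)).add
    ((WeakDual.eval_continuous f).comp (continuous_subtype_val.comp continuous_snd))⟩

/-- `M_f`: the weak* closure of the ideal generated by all modified spherical differences
`D_{f;y}`, `y ∈ G`. -/
def sphIdeal [IsGelfandPair K] (f : C(G, ℂ)) : Ideal (invMeasures K) where
  carrier := closure (Ideal.span (Set.range (sphDiff K f)) : Set (invMeasures K))
  add_mem' {μ ν} hμ hν := map_mem_closure₂ continuous_add hμ hν
    fun _ ha _ hb => add_mem ha hb
  zero_mem' := subset_closure (zero_mem _)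
  smul_mem' ρ μ hμ := by
    rw [smul_eq_mul, IsGelfandPair.mul_comm]
    refine map_mem_closure (f := fun a => a * ρ) (continuous_mul_right K ρ) hμ fun a ha => ?_
    change a * ρ ∈ Ideal.span _
    rw [IsGelfandPair.mul_comm]
    exact Ideal.mul_mem_left _ ρ ha

/-- A maximal ideal of `M_c(G//K)` is exponential if it is the kernel of a continuous algebra
homomorphism of `M_c(G//K)` onto `ℂ`. -/
def IsExponentialMaximal (I : Ideal (invMeasures K)) : Prop :=
  I.IsMaximal ∧ ∃ Φ : invMeasures K →ₐ[ℂ] ℂ,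
    Continuous Φ ∧ Function.Surjective Φ ∧ I = RingHom.ker Φ

end Spherical

end GelfandPairs

end

open GelfandPairs

/-!
Write `L μ = ⟨μ, f̌⟩` for `μ` in `M_c(G//K)`. As `f` is `K`-invariant, `L (δ_{y⁻¹}^#) = f y`, so for
normed `f` the functional `L` is unital and vanishes on the generators of `M_f`.

The functional equation turns `μ * f` into `L μ • f` (`SphericalEquation.act_eq`). Conversely, an
eigenfunction of all `τ_y` has eigenvalue `f y`, because `τ_y f (e) = f y`, and then
`∫ f (y k x) dω(k) = τ_y f (x) = f y * f x` (`sphericalEquation_of_translate`). The identity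
`⟨μ * ν, f̌⟩ = ⟨μ, (ν * f)ˇ⟩` (`conv_check`) relates this to the multiplicativity of `L`: if
`ν * f = L ν • f` for all `ν`, then `L` is multiplicative, and evaluating a multiplicative `L` on
`δ_{x⁻¹}^# * ν` gives `(ν * f) (x) = L ν * f x`.

The ideal `M_f` enters through duality. Every weak* continuous functional on `M_c(G)` is the
evaluation at some `g` in `C(G)`, so a continuous functional on `M_c(G//K)` is determined by its
values at the `δ_y^#`; if it vanishes on the generators of `M_f`, it is a multiple of `L`
(`continuous_functional_eq`). This has two consequences. A character with kernel `M_f` is `L`, and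
by the Hahn–Banach theorem the closed subspace `M_f` contains the kernel of `L`
(`mem_sphIdeal_of_apply_check_eq_zero`). The reverse inclusion holds as soon as `L` is
multiplicative, since the kernel of `L` is then a closed ideal.
-/

namespace GelfandPairs

open MeasureTheory

/-! ### Weak* duality -/

/-- A weak* continuous functional is the evaluation at some function. -/
lemma exists_eval_eq {X : Type*} [TopologicalSpace X] (φ : CompMeasure X →L[ℂ] ℂ) :
    ∃ g : C(X, ℂ), ∀ μ : CompMeasure X, φ μ = μ g := by
  obtain ⟨g, hg⟩ := @LinearMap.dualEmbedding_surjective ℂ (CompMeasure X) C(X, ℂ) _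
    WeakDual.instAddCommGroup _ _ _ (topDualPairing ℂ C(X, ℂ)) φ
  exact ⟨g, fun μ => (DFunLike.congr_fun hg μ).symm⟩

lemma locallyConvexSpace_compMeasure {X : Type*} [TopologicalSpace X] :
    LocallyConvexSpace ℝ (CompMeasure X) := by
  let ev : CompMeasure X →ₗ[ℝ] C(X, ℂ) → ℂ :=
    { toFun := fun μ => μ, map_add' := fun _ _ => rfl, map_smul' := fun _ _ => rfl }
  exact Topology.IsInducing.locallyConvexSpace (f := ev) ⟨rfl⟩

/-- Hahn–Banach in the weak* topology: a closed subspace of `M_c(X)` is an intersection of kernels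
of evaluations. -/
lemma exists_annihilator_apply_ne_zero {X : Type*} [TopologicalSpace X]
    (S : Submodule ℂ (CompMeasure X)) (hS : IsClosed (S : Set (CompMeasure X)))
    {μ : CompMeasure X} (hμ : μ ∉ S) :
    ∃ g : C(X, ℂ), (∀ ν ∈ S, ν g = 0) ∧ μ g ≠ 0 := by
  have htower : IsScalarTower ℝ ℂ (CompMeasure X) :=
    ⟨fun a b μ => DFunLike.ext _ _ fun f => smul_assoc a b (μ f)⟩
  have hlc := locallyConvexSpace_compMeasure (X := X)
  have hconv : Convex ℝ (S : Set (CompMeasure X)) := fun a ha b hb r s _ _ _ =>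
    S.add_mem (S.smul_mem (r : ℂ) ha) (S.smul_mem (s : ℂ) hb)
  obtain ⟨φ, u, hφS, hφμ⟩ := RCLike.geometric_hahn_banach_closed_point (𝕜 := ℂ) hconv hS hμ
  obtain ⟨g, hg⟩ := exists_eval_eq φ
  have hu : 0 < u := by simpa using hφS 0 S.zero_mem
  refine ⟨g, fun ν hν => ?_, fun h0 => ?_⟩
  · -- a functional with real part bounded above on a subspace vanishes there
    by_contra hne
    have h := hφS ((u / ν g : ℂ) • ν) (S.smul_mem _ hν)
    rw [map_smul, hg, smul_eq_mul, div_mul_cancel₀ _ hne] at h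
    simp at h
  · rw [hg, h0, map_zero] at hφμ
    exact hφμ.not_gt hu

/-! ### Convolution with invariant functions -/

variable {G : Type*} [Group G] [TopologicalSpace G] [IsTopologicalGroup G] {K : Subgroup G}

lemma IsInvariantFun.check {f : C(G, ℂ)} (hf : IsInvariantFun K f) :
    IsInvariantFun K (check f) := fun x k hk l hl => by
  simpa [mul_assoc] using hf x⁻¹ l⁻¹ (inv_mem hl) k⁻¹ (inv_mem hk)

lemma act_one_apply (μ : CompMeasure G) (f : C(G, ℂ)) : act μ f 1 = μ (check f) :=
  congrArg μ (ContinuousMap.ext fun y => by simp)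

variable [LocallyCompactSpace G] in
/-- `⟨μ * ν, f̌⟩ = ⟨μ, (ν * f)ˇ⟩`, the link between products of measures and eigenfunctions. -/
lemma conv_check (μ ν : CompMeasure G) (f : C(G, ℂ)) :
    conv μ ν (check f) = μ (check (act ν f)) := by
  refine congrArg μ (ContinuousMap.ext fun x => congrArg ν (ContinuousMap.ext fun y => ?_))
  simp

variable [MeasurableSpace G] [BorelSpace G] [CompactSpace K]

lemma SphericalEquation.isNormed {f : C(G, ℂ)} (h : SphericalEquation K f) (h0 : f ≠ 0)
    (hf : IsInvariantFun K f) : IsNormed f := by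
  obtain ⟨x, hx⟩ : ∃ x, f x ≠ 0 := by
    by_contra! hne
    exact h0 (ContinuousMap.ext hne)
  have h1 : ∀ k : K, f (x * k * 1) = f x := fun k => by
    simpa using hf x 1 (one_mem K) k k.2
  have h2 := h x 1
  simp only [h1, integral_const, probReal_univ, one_smul] at h2
  exact mul_left_cancel₀ hx (by rw [← h2, mul_one])

variable [LocallyCompactSpace G]

/-- An eigenfunction of all `τ_y` solves the spherical equation: `c_y = τ_y f (e) = f y`. -/
lemma sphericalEquation_of_translate [T2Space G] {f : C(G, ℂ)} (hf : IsInvariantFun K f)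
    (h1 : IsNormed f) (h : ∀ y : G, ∃ c : ℂ, translate K y f = c • f) :
    SphericalEquation K f := by
  intro y x
  obtain ⟨c, hc⟩ := h y
  have key : ∀ x, ∫ k : K, f (y * k * x) ∂(normHaar K) = c * f x := by
    intro x
    rw [← smul_eq_mul, ← ContinuousMap.smul_apply, ← hc, translate_apply]
    congr 1
    ext l
    have : ∀ k : K, f (k * y * l * x) = f (y * l * x) := fun k => by
      simpa [mul_assoc] using hf (y * l * x) k k.2 1 (one_mem K)
    simp [this]
  have hcy : f y = c := by
    have h2 := key 1
    have : ∀ k : K, f (y * k) = f y := fun k => by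
      simpa using hf y 1 (one_mem K) k k.2
    simpa only [this, show f 1 = 1 from h1, integral_const, probReal_univ, one_smul, mul_one]
      using h2
  rw [key, hcy]

variable [T2Space G]

lemma diracProj_apply_of_invariant {f : C(G, ℂ)} (hf : IsInvariantFun K f) (x : G) :
    (diracProj K x : CompMeasure G) f = f x := by
  rw [diracProj_apply, proj_eq_self hf]

lemma one_apply_of_invariant {f : C(G, ℂ)} (hf : IsInvariantFun K f) :
    ((1 : invMeasures K) : CompMeasure G) f = f 1 :=
  diracProj_apply_of_invariant hf 1

lemma apply_lshift {μ : CompMeasure G} (hμ : μ ∈ invMeasures K) (f : C(G, ℂ)) {k : G}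
    (hk : k ∈ K) : μ (lshift f k) = μ f := by
  rw [← apply_avgL hμ (lshift f k), ← apply_avgL hμ f]
  congr 1
  ext y
  have := integral_mul_left_eq_self (μ := normHaar K) (fun l : K => f (l * y)) ⟨k, hk⟩
  simpa [avgL_apply, mul_assoc] using this

lemma IsInvariantFun.act {f : C(G, ℂ)} (hf : IsInvariantFun K f) {μ : CompMeasure G}
    (hμ : μ ∈ invMeasures K) : IsInvariantFun K (act μ f) := by
  intro x k hk l hl
  refine Eq.trans ?_ (apply_lshift hμ _ (inv_mem hk))
  refine congrArg μ (ContinuousMap.ext fun y => ?_)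
  simpa [mul_assoc] using hf (y⁻¹ * (k * x)) 1 (one_mem K) l hl

/-- A solution of the spherical equation is an eigenfunction of convolution by every invariant
measure: averaging `y ↦ f (y⁻¹ x)` over `K` on the left gives `f (y⁻¹) f (x)`. -/
lemma SphericalEquation.act_eq {f : C(G, ℂ)} (h : SphericalEquation K f) {μ : CompMeasure G}
    (hμ : μ ∈ invMeasures K) : act μ f = μ (GelfandPairs.check f) • f := by
  ext x
  refine (apply_avgL hμ _).symm.trans ?_
  have : avgL K ⟨fun y => f (y⁻¹ * x), by fun_prop⟩ = f x • GelfandPairs.check f := by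
    ext y
    rw [avgL_apply, ← integral_inv_eq_self]
    simpa [mul_comm (f x)] using h y⁻¹ x
  rw [this, map_smul]
  simp [mul_comm]

/-! ### Continuous functionals on the algebra of invariant measures -/

lemma continuous_projMeas :
    Continuous fun μ : CompMeasure G => (⟨projMeas K μ, projMeas_mem μ⟩ : invMeasures K) :=
  (WeakDual.continuous_of_continuous_eval fun f => WeakDual.eval_continuous (proj K f)).subtype_mk _

lemma projMeas_coe (μ : invMeasures K) :
    (⟨projMeas K μ.1, projMeas_mem μ.1⟩ : invMeasures K) = μ :=
  coe_eq_of_apply fun f => (μ.2 f).symm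

/-- The projection `μ ↦ μ^#` onto the invariant measures. -/
noncomputable def projMeasLM (K : Subgroup G) [CompactSpace K] : CompMeasure G →ₗ[ℂ] invMeasures K where
  toFun μ := ⟨projMeas K μ, projMeas_mem μ⟩
  map_add' _ _ := rfl
  map_smul' _ _ := rfl

lemma sphDiff_apply (f g : C(G, ℂ)) (y : G) : (sphDiff K f y : CompMeasure G) g =
    proj K g y⁻¹ - f y * ((1 : invMeasures K) : CompMeasure G) g := by
  rw [eq_sub_iff_add_eq]
  exact congrArg (fun μ : invMeasures K => (μ : CompMeasure G) g)
    (sub_add_cancel (diracProj K y⁻¹) (f y • 1))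

lemma sphDiff_apply_check {f : C(G, ℂ)} (hf : IsInvariantFun K f) (h1 : IsNormed f) (y : G) :
    (sphDiff K f y : CompMeasure G) (check f) = 0 := by
  rw [sphDiff_apply, proj_eq_self hf.check, one_apply_of_invariant hf.check]
  simp [show f 1 = 1 from h1]

/-- An evaluation that vanishes on all `δ_{y⁻¹}^# - f(y) δ_e^#` is a multiple of `μ ↦ ⟨μ, f̌⟩`. -/
lemma eval_eq_of_sphDiff {f g : C(G, ℂ)}
    (hg : ∀ y, (sphDiff K f y : CompMeasure G) g = 0) (μ : invMeasures K) :
    (μ : CompMeasure G) g =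
      ((1 : invMeasures K) : CompMeasure G) g * (μ : CompMeasure G) (check f) := by
  have : proj K g = ((1 : invMeasures K) : CompMeasure G) g • check f := by
    ext x
    have h := hg x⁻¹
    rw [sphDiff_apply, inv_inv] at h
    rw [sub_eq_zero.1 h]
    simp [mul_comm]
  rw [μ.2 g, this, map_smul, smul_eq_mul]

/-- A weak* continuous functional on `M_c(G//K)` that vanishes on all `δ_{y⁻¹}^# - f(y) δ_e^#` is a
multiple of `μ ↦ ⟨μ, f̌⟩`. -/
lemma continuous_functional_eq {f : C(G, ℂ)} (φ : invMeasures K →ₗ[ℂ] ℂ) (hφ : Continuous φ)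
    (h : ∀ y, φ (sphDiff K f y) = 0) (μ : invMeasures K) :
    φ μ = φ 1 * (μ : CompMeasure G) (check f) := by
  obtain ⟨g, hg⟩ := exists_eval_eq
    (⟨φ.comp (projMeasLM K), hφ.comp continuous_projMeas⟩ : CompMeasure G →L[ℂ] ℂ)
  have hg' : ∀ ν : invMeasures K, φ ν = (ν : CompMeasure G) g := fun ν =>
    (congrArg φ (projMeas_coe ν)).symm.trans (hg ν)
  rw [hg', hg', eval_eq_of_sphDiff fun y => (hg' _).symm.trans (h y)]

variable [IsGelfandPair K]

lemma isClosed_sphIdeal (f : C(G, ℂ)) :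
    IsClosed (sphIdeal K f : Set (invMeasures K)) := isClosed_closure

lemma sphDiff_mem_sphIdeal (f : C(G, ℂ)) (y : G) : sphDiff K f y ∈ sphIdeal K f :=
  subset_closure (Ideal.subset_span ⟨y, rfl⟩)

/-- `M_f` contains the kernel of `μ ↦ ⟨μ, f̌⟩`: a continuous functional that separates a measure
from `M_f` would be a multiple of `μ ↦ ⟨μ, f̌⟩`. -/
lemma mem_sphIdeal_of_apply_check_eq_zero {f : C(G, ℂ)} {μ : invMeasures K}
    (hμ : (μ : CompMeasure G) (check f) = 0) : μ ∈ sphIdeal K f := by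
  by_contra hne
  -- the closed subspace `{ν | ν^# ∈ M_f}` of `M_c(G)`
  let S : Submodule ℂ (CompMeasure G) :=
    ((sphIdeal K f).restrictScalars ℂ).comap (projMeasLM K)
  have hS : IsClosed (S : Set (CompMeasure G)) :=
    (isClosed_sphIdeal f).preimage continuous_projMeas
  have hmem : ∀ ν : invMeasures K, (ν : CompMeasure G) ∈ S ↔ ν ∈ sphIdeal K f := fun ν =>
    iff_of_eq (congrArg (· ∈ sphIdeal K f) (projMeas_coe ν))
  obtain ⟨g, hg, hgμ⟩ := exists_annihilator_apply_ne_zero S hS (mt (hmem μ).1 hne)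
  refine hgμ ?_
  rw [eval_eq_of_sphDiff (f := f) fun y => hg _ ((hmem _).2 (sphDiff_mem_sphIdeal f y)), hμ,
    mul_zero]

/-- If `μ ↦ ⟨μ, f̌⟩` is multiplicative, its kernel is a closed ideal, hence contains `M_f`. -/
lemma apply_check_eq_zero_of_mem_sphIdeal {f : C(G, ℂ)} (hf : IsInvariantFun K f)
    (h1 : IsNormed f)
    (hmul : ∀ μ ν : invMeasures K, ((μ * ν : invMeasures K) : CompMeasure G) (check f) =
      (μ : CompMeasure G) (check f) * (ν : CompMeasure G) (check f))
    {μ : invMeasures K} (hμ : μ ∈ sphIdeal K f) : (μ : CompMeasure G) (check f) = 0 := by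
  have hc : IsClosed {ν : invMeasures K | (ν : CompMeasure G) (check f) = 0} :=
    isClosed_singleton.preimage
      ((WeakDual.eval_continuous (check f)).comp continuous_subtype_val)
  refine closure_minimal (fun ν hν => ?_) hc hμ
  change (ν : CompMeasure G) (check f) = 0
  refine Submodule.span_induction ?_ rfl (fun a b _ _ ha hb => ?_) (fun a b _ hb => ?_) hν
  · rintro _ ⟨y, rfl⟩
    exact sphDiff_apply_check hf h1 y
  · exact (congrArg₂ (· + ·) ha hb).trans (add_zero _)
  · rw [smul_eq_mul, hmul, hb, mul_zero]

/-- A multiplicative `μ ↦ ⟨μ, f̌⟩` makes `M_f`, being its kernel, exponential. -/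
lemma isExponentialMaximal_of_multiplicative {f : C(G, ℂ)} (hf : IsInvariantFun K f)
    (h1 : IsNormed f)
    (hmul : ∀ μ ν : invMeasures K, ((μ * ν : invMeasures K) : CompMeasure G) (check f) =
      (μ : CompMeasure G) (check f) * (ν : CompMeasure G) (check f))
    (hker : ∀ μ : invMeasures K, (μ : CompMeasure G) (check f) = 0 ↔ μ ∈ sphIdeal K f) :
    IsExponentialMaximal K (sphIdeal K f) := by
  let Φ : invMeasures K →ₐ[ℂ] ℂ := AlgHom.ofLinearMap
    { toFun := fun μ => (μ : CompMeasure G) (check f)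
      map_add' := fun _ _ => rfl
      map_smul' := fun _ _ => rfl }
    ((one_apply_of_invariant hf.check).trans (by simpa [IsNormed] using h1)) hmul
  have hsurj : Function.Surjective Φ := fun c => ⟨algebraMap ℂ _ c, Φ.commutes c⟩
  have hI : sphIdeal K f = RingHom.ker Φ := Ideal.ext fun μ => (hker μ).symm
  exact ⟨hI ▸ RingHom.ker_isMaximal_of_surjective Φ hsurj, Φ,
    (WeakDual.eval_continuous (check f)).comp continuous_subtype_val, hsurj, hI⟩

/-- A continuous character with kernel `M_f` is `μ ↦ ⟨μ, f̌⟩`, so the latter is multiplicative. -/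
lemma IsExponentialMaximal.apply_check_mul {f : C(G, ℂ)}
    (h : IsExponentialMaximal K (sphIdeal K f)) (μ ν : invMeasures K) :
    ((μ * ν : invMeasures K) : CompMeasure G) (check f) =
      (μ : CompMeasure G) (check f) * (ν : CompMeasure G) (check f) := by
  obtain ⟨-, Φ, hΦ, -, hI⟩ := h
  have hL : ∀ ρ : invMeasures K, Φ ρ = (ρ : CompMeasure G) (check f) := fun ρ => by
    have := continuous_functional_eq (f := f) Φ.toLinearMap hΦ
      (fun y => (RingHom.mem_ker (f := Φ)).1 (hI ▸ sphDiff_mem_sphIdeal f y)) ρ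
    simpa using this
  rw [← hL, ← hL, ← hL, map_mul]

end GelfandPairs

open GelfandPairs
/-- Characterizations of `K`-spherical functions. -/
theorem mainTheorem5 {G : Type*} [Group G] [TopologicalSpace G] [IsTopologicalGroup G]
    [LocallyCompactSpace G] [T2Space G] [MeasurableSpace G] [BorelSpace G]
    (K : Subgroup G) [CompactSpace K] [IsGelfandPair K]
    (f : C(G, ℂ)) (hf : IsInvariantFun K f) :
    List.TFAE [
      IsSpherical K f,
      f ≠ 0 ∧ SphericalEquation K f,
      IsNormed f ∧ ∀ μ : invMeasures K, ∃ c : ℂ, act (μ : CompMeasure G) f = c • f,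
      IsNormed f ∧ ∀ y : G, ∃ c : ℂ, translate K y f = c • f,
      IsNormed f ∧ IsExponentialMaximal K (sphIdeal K f),
      IsNormed f ∧ (∃ μ : invMeasures K, (μ : CompMeasure G) (check f) ≠ 0) ∧
        (∀ μ ν : invMeasures K, ((μ * ν : invMeasures K) : CompMeasure G) (check f) =
          (μ : CompMeasure G) (check f) * (ν : CompMeasure G) (check f)) ∧
        ∀ μ : invMeasures K, (μ : CompMeasure G) (check f) = 0 ↔ μ ∈ sphIdeal K f] := by
  have mul_of_eigen : (∀ μ : invMeasures K, ∃ c : ℂ, act (μ : CompMeasure G) f = c • f) →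
      IsNormed f → ∀ μ ν : invMeasures K,
      ((μ * ν : invMeasures K) : CompMeasure G) (check f) =
        (μ : CompMeasure G) (check f) * (ν : CompMeasure G) (check f) := by
    intro h h1 μ ν
    obtain ⟨c, hc⟩ := h ν
    have hcν : (ν : CompMeasure G) (check f) = c := by
      rw [← act_one_apply, hc]
      simp [show f 1 = 1 from h1]
    rw [coe_mul, conv_check, hc, hcν, mul_comm]
    exact map_smul μ.1 c (check f)
  have eigen_of_mul : (∀ μ ν : invMeasures K,
      ((μ * ν : invMeasures K) : CompMeasure G) (check f) =
        (μ : CompMeasure G) (check f) * (ν : CompMeasure G) (check f)) →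
      ∀ μ : invMeasures K, ∃ c : ℂ, act (μ : CompMeasure G) f = c • f := by
    refine fun hmul ν => ⟨(ν : CompMeasure G) (check f), ContinuousMap.ext fun x => ?_⟩
    have h := hmul (diracProj K x⁻¹) ν
    rw [coe_mul, conv_check, diracProj_apply_of_invariant (hf.act ν.2).check,
      diracProj_apply_of_invariant hf.check, check_apply, check_apply, inv_inv] at h
    rw [h, mul_comm]
    rfl
  tfae_have 1 → 2 := fun h => h.2
  tfae_have 2 → 1 := fun h => ⟨hf, h⟩
  tfae_have 2 → 3 := fun h => ⟨h.2.isNormed h.1 hf, fun μ => ⟨_, h.2.act_eq μ.2⟩⟩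
  tfae_have 3 → 4 := fun h => ⟨h.1, fun y => h.2 (diracProj K y⁻¹)⟩
  tfae_have 4 → 2 := fun h => by
    refine ⟨?_, sphericalEquation_of_translate hf h.1 h.2⟩
    rintro rfl
    exact zero_ne_one h.1
  tfae_have 3 → 6 := fun h => by
    have hmul := mul_of_eigen h.2 h.1
    refine ⟨h.1, ⟨1, ?_⟩, hmul, fun μ => ⟨mem_sphIdeal_of_apply_check_eq_zero,
      apply_check_eq_zero_of_mem_sphIdeal hf h.1 hmul⟩⟩
    rw [one_apply_of_invariant hf.check, check_apply, inv_one, show f 1 = 1 from h.1]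
    exact one_ne_zero
  tfae_have 6 → 5 := fun h =>
    ⟨h.1, isExponentialMaximal_of_multiplicative hf h.1 h.2.2.1 h.2.2.2⟩
  tfae_have 5 → 3 := fun h => ⟨h.1, eigen_of_mul h.2.apply_check_mul⟩
  tfae_finish
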